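/- **Definitions.** Let $I$ be an infinite set, and let $\Delta_I\subset[0,1]^I$ be the convex hull of the unit vectors $e_k$, $k\in I$, with the product topology. For a set $Y$ put $\Delta(Y)=\Delta_I\times Y^I$ (formal convex combinations), and for $A\subset Y$ put $\Delta(A)=\{(d,a)\in\Delta(Y): d_i\neq 0\Rightarrow a_i\in A\}$. Let $Y$ be a uniform space with an open base $\mathcal B$ of its uniformity of the smallest possible cardinality, and write $B(A,W)=\{y:(x,y)\in W\text{ for some }x\in A\}$. Let $Z$ be the set $Y$ with some topology, $\mathcal V$ a class of multifunctions between topological spaces, $\mathcal A$ a family of nonempty subsets of $Y$, $\mathrm{conv}$ a map from $\mathcal A$ to the nonempty subsets of $Y$, and $Q'\subset\Delta(Y)$ a set containing $\Delta(B(A,W))$ for all $A\in\mathcal A$, $W\in\mathcal B$. Given a multifunction $C:Q'\to Y$, the triple $(Y,C,Z)$ is a *convexity* associated with $\mathcal A,\mathrm{conv},\mathcal V,Q'$ if * (D) for every $a\in Y^I$ and every finite-dimensional face $\Delta_n$ of $\Delta_I$ (the convex hull of finitely many, at least one, of the $e_k$) with $\Delta_n\times\{a\}\subset Q'$, the multifunction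 $C(\cdot,a):\Delta_n\to Z$ belongs to $\mathcal V$; * (E) for every $U\in\mathcal B$ there is $W\in\mathcal B$ such that $C(q)\subset B(\mathrm{conv}(A),U)$ for all $A\in\mathcal A$ and all $q\in\Delta(B(A,W))$. It is *global* if $Q'=\Delta(Y)$. A compact Hausdorff space $Y$ is an *ANR* if, whenever it is embedded as a closed subspace of a compact Hausdorff space $X$, it is a retract of an open neighbourhood of itself in $X$. **Theorem.** Let $Y$ be a compact Hausdorff ANR, with its unique compatible uniformity and any open base $\mathcal B$ of it of the smallest cardinality. Let $\mathcal V$ be the class of all upper semicontinuous multifunctions each of whose values is either a singleton or the whole target space (so, for multifunctions into $Y$, a singleton or $Y$). Then there exists a multifunction $C:\Delta(Y)\to Y$ such that $(Y,C,Y)$ is a global convexity associated with $\mathcal A=\{\{y\}:y\in Y\}$, $\mathrm{conv}(\{y\})=\{y\}$ for all $y\in Y$, and $\mathcal V$. -/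

import Mathlib

open Set Topology Uniformity

universe u v

open Classical in
/-- The (possibly infinite-dimensional) simplex `Δ_ω ⊆ [0,1]^I` spanned by the unit vectors `e_k`,
`k ∈ I`: their convex hull, with the topology induced by the product topology of `I → ℝ`. -/
def infSimplex (I : Type v) : Set (I → ℝ) :=
  convexHull ℝ (range fun k : I => (Pi.single k (1 : ℝ) : I → ℝ))

/-- The face of `Δ_ω` spanned by the unit vectors `e_k`, `k ∈ K`; for `K` finite with `n + 1`
elements these are the simplices `Δ_n` of `Δ_ω`. -/
def simplexFace {I : Type v} (K : Set I) : Set (infSimplex I) :=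
  {d | ∀ i, i ∉ K → (d : I → ℝ) i = 0}

/-- `Δ(Y) = Δ_ω × Y^ω`: formal convex combinations `(d, a)` of points of `Y`. -/
abbrev FormalComb (I : Type v) (Y : Type u) : Type (max u v) :=
  infSimplex I × (I → Y)

/-- `Δ(A)`: formal convex combinations of elements of `A`. -/
def formalCombOf (I : Type v) {Y : Type u} (A : Set Y) : Set (FormalComb I Y) :=
  {p | ∀ i, (p.1 : I → ℝ) i ≠ 0 → p.2 i ∈ A}

/-- `B(A, W)`: the union of the balls `{y | (x, y) ∈ W}`, `x ∈ A`. -/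
def uniformNhd {Y : Type u} (A : Set Y) (W : Set (Y × Y)) : Set Y :=
  ⋃ x ∈ A, UniformSpace.ball x W

/-- A base of the uniformity of `Y` that consists of open entourages. -/
def IsOpenUniformBase {Y : Type u} [UniformSpace Y] (B : Set (Set (Y × Y))) : Prop :=
  (𝓤 Y).HasBasis (fun V : Set (Y × Y) => V ∈ B) id ∧ ∀ V ∈ B, IsOpen V

/-- An open uniform base of the smallest possible cardinality. -/
def IsMinimalOpenUniformBase {Y : Type u} [UniformSpace Y] (B : Set (Set (Y × Y))) : Prop :=
  IsOpenUniformBase B ∧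
    ∀ B' : Set (Set (Y × Y)), IsOpenUniformBase B' → Cardinal.mk B ≤ Cardinal.mk B'

/-- A class of multifunctions `F : X → Z` between topological spaces. -/
abbrev MultifunctionClass : Type (max (u + 1) (v + 1)) :=
  ∀ (X : Type v) (Z : Type u) [TopologicalSpace X] [TopologicalSpace Z], (X → Set Z) → Prop

/-- `(Y, C, Z)` is a convexity associated with `𝒜`, `conv`, `𝒱`, `Q'`. Here `Y` is a uniform space
with minimal open base `B`, and `Z` is the set `Y` with a further topology `tZ`. -/
structure IsConvexity (I : Type v) {Y : Type u} [UniformSpace Y] (B : Set (Set (Y × Y)))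
    (tZ : TopologicalSpace Y) (𝒱 : MultifunctionClass.{u, v}) (𝒜 : Set (Set Y))
    (conv : 𝒜 → Set Y) (Q' : Set (FormalComb I Y)) (C : Q' → Set Y) : Prop where
  base : IsMinimalOpenUniformBase B
  admissible_nonempty : ∀ A ∈ 𝒜, A.Nonempty
  conv_nonempty : ∀ A : 𝒜, (conv A).Nonempty
  domain : ∀ A ∈ 𝒜, ∀ W ∈ B, formalCombOf I (uniformNhd A W) ⊆ Q'
  /-- Condition (D): on each finite-dimensional face, `C(·, a)` belongs to `𝒱`, as a multifunction
  into `Z`. -/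
  mem_class : ∀ (a : I → Y) (K : Finset I), K.Nonempty →
    ∀ h : ∀ d ∈ simplexFace (K : Set I), (d, a) ∈ Q',
      @𝒱 (simplexFace (K : Set I)) Y inferInstance tZ (fun d => C ⟨(d.1, a), h d.1 d.2⟩)
  /-- Condition (E): `C(Δ(B(A, W))) ⊆ B(conv A, U)`, with `W` independent of `A`. -/
  uniform_hull : ∀ U ∈ B, ∃ W ∈ B, ∀ A : 𝒜, ∀ q : Q',
    (q : FormalComb I Y) ∈ formalCombOf I (uniformNhd (A : Set Y) W) →
      C q ⊆ uniformNhd (conv A) U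

/-- The class of upper semicontinuous multifunctions each of whose values is a singleton or the
whole target space. -/
def uscSingletonOrWhole : MultifunctionClass.{u, v} :=
  fun X Z _ _ F => UpperHemicontinuous F ∧ ∀ x : X, (∃ z : Z, F x = {z}) ∨ F x = univ

/-- Absolute neighbourhood retract, for a compact Hausdorff space `Y`: whenever `Y` is embedded as
a closed subspace of a compact Hausdorff space `X`, its image is a retract of an open
neighbourhood of it in `X` (the retraction is written as a left inverse of the embedding).
As `Y` embeds into the cube `[0,1]^{C(Y,[0,1])}`, spaces `X` of the universe of `Y` suffice. -/
def IsCompactANR (Y : Type u) [TopologicalSpace Y] : Prop :=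
  ∀ (X : Type u) [TopologicalSpace X] [CompactSpace X] [T2Space X] (e : Y → X),
    IsClosedEmbedding e →
      ∃ N : Set X, IsOpen N ∧ ∃ he : ∀ y, e y ∈ N,
        ∃ r : N → Y, Continuous r ∧ ∀ y, r ⟨e y, he y⟩ = y

/-!
Embed `Y` into a compact convex subset `S` of a locally convex space; as `Y` is an ANR, it is a
retract of an open set `N` of `S`. A formal convex combination is sent to the retraction of its
barycenter if the barycenter lies in `N`, and to all of `Y` otherwise. Condition (D) holds because
barycenters depend continuously on the weights and a partial map with open domain, extended by the
value `Y`, is upper semicontinuous. Condition (E) holds because a combination of points near `y` has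
its barycenter near `y`, by local convexity, and the extended retraction is upper semicontinuous,
hence uniformly so along the compact set `Y`.
-/

universe w

section InfSimplex

variable {I : Type v} {d : I → ℝ}

lemma nonneg_of_mem_infSimplex (hd : d ∈ infSimplex I) (i : I) : 0 ≤ d i := by
  classical
  have hsub : infSimplex I ⊆ Ici 0 :=
    convexHull_min (range_subset_iff.2 fun _ => Pi.single_nonneg.2 zero_le_one) (convex_Ici 0)
  exact hsub hd i

lemma finsum_eq_one_of_mem_infSimplex (hd : d ∈ infSimplex I) : ∑ᶠ i, d i = 1 := by
  classical
  obtain ⟨ι, _, w, z, -, hw, hz, rfl⟩ := mem_convexHull_iff_exists_fintype.1 hd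
  choose k hk using hz
  have hsupp (j : ι) (i : I) (hi : i ≠ k j) : w j * z j i = 0 := by
    simp [← hk j, hi]
  have hfin (j : ι) : (Function.support fun i => w j * z j i).Finite :=
    (finite_singleton (k j)).subset fun i hi => by_contra fun h => hi (hsupp j i h)
  calc ∑ᶠ i, (∑ j, w j • z j) i
      = ∑ᶠ i, ∑ j, w j * z j i := by simp
    _ = ∑ j, ∑ᶠ i, w j * z j i := finsum_sum_comm _ _ fun j _ => hfin j
    _ = ∑ j, w j * z j (k j) :=
        Finset.sum_congr rfl fun j _ => finsum_eq_single _ (k j) (hsupp j)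
    _ = 1 := by simp [← hk, hw]

lemma finsum_smul_mem_of_mem_infSimplex {E : Type w} [AddCommGroup E] [Module ℝ E] {s : Set E}
    (hs : Convex ℝ s) (hd : d ∈ infSimplex I) {z : I → E} (hz : ∀ i, d i ≠ 0 → z i ∈ s) :
    ∑ᶠ i, d i • z i ∈ s :=
  hs.finsum_mem (nonneg_of_mem_infSimplex hd) (finsum_eq_one_of_mem_infSimplex hd) hz

end InfSimplex

section Barycenter

variable {I : Type v} {E : Type w} [AddCommGroup E] [Module ℝ E] {S : Set E}

/-- The actual convex combination, in a convex subset `S` of a real vector space, represented by a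
formal convex combination of points of `S`. -/
noncomputable def FormalComb.barycenter (hS : Convex ℝ S) (q : FormalComb I S) : S :=
  ⟨∑ᶠ i, (q.1 : I → ℝ) i • (q.2 i : E),
    finsum_smul_mem_of_mem_infSimplex hS q.1.2 fun i _ => (q.2 i).2⟩

lemma continuous_barycenter_simplexFace [TopologicalSpace E] [ContinuousAdd E]
    [ContinuousSMul ℝ E] (hS : Convex ℝ S) (a : I → S) (K : Finset I) :
    Continuous fun d : simplexFace (K : Set I) => FormalComb.barycenter hS (d.1, a) := by
  refine Continuous.subtype_mk ?_ _
  have hsum (d : simplexFace (K : Set I)) :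
      ∑ᶠ i, (d.1 : I → ℝ) i • (a i : E) = ∑ i ∈ K, (d.1 : I → ℝ) i • (a i : E) :=
    finsum_eq_sum_of_support_subset _ fun i hi =>
      by_contra fun hiK => hi (by simp [d.2 i hiK])
  simp only [hsum]
  exact continuous_finsetSum _ fun i _ =>
    ((continuous_apply i).comp (continuous_subtype_val.comp continuous_subtype_val)).smul
      continuous_const

variable [UniformSpace E] [IsUniformAddGroup E] [LocallyConvexSpace ℝ E]

variable (E) in
lemma hasBasis_uniformity_convex_ball :
    (𝓤 E).HasBasis (fun V => V ∈ 𝓤 E ∧ ∀ x, Convex ℝ (UniformSpace.ball x V)) id := by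
  have hbasis := (LocallyConvexSpace.convex_basis_zero ℝ E).comap fun p : E × E => p.2 - p.1
  rw [← uniformity_eq_comap_nhds_zero] at hbasis
  refine Filter.hasBasis_self.2 fun V hV => ?_
  obtain ⟨O, hO, hOV⟩ := hbasis.mem_iff.1 hV
  refine ⟨_, hbasis.mem_of_mem hO, fun x => ?_, hOV⟩
  simpa only [UniformSpace.ball, preimage_preimage, id, sub_eq_add_neg] using
    hO.2.translate_preimage_left (-x)

lemma exists_entourage_barycenter_mem_ball (I : Type v) (hS : Convex ℝ S) {V : Set (S × S)}
    (hV : V ∈ 𝓤 S) :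
    ∃ W ∈ 𝓤 S, ∀ x, ∀ q ∈ formalCombOf I (UniformSpace.ball x W),
      FormalComb.barycenter hS q ∈ UniformSpace.ball x V := by
  rw [uniformity_subtype] at hV ⊢
  obtain ⟨W, ⟨hW, hconv⟩, hWV⟩ := ((hasBasis_uniformity_convex_ball E).comap _).mem_iff.1 hV
  exact ⟨_, Filter.preimage_mem_comap hW, fun x q hq =>
    hWV (finsum_smul_mem_of_mem_infSimplex (hconv x) q.1.2 hq)⟩

end Barycenter

section WholeExtension

variable {X : Type w} {Y : Type u} {N : Set X}

/-- The extension of a partial map `r`, defined on `N`, to a multifunction whose value at a point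
outside `N`, where the condition on `y` is vacuous, is the whole target space. -/
def wholeExtension (r : N → Y) (x : X) : Set Y :=
  {y | ∀ hx : x ∈ N, r ⟨x, hx⟩ = y}

lemma wholeExtension_of_mem (r : N → Y) {x : X} (hx : x ∈ N) :
    wholeExtension r x = {r ⟨x, hx⟩} :=
  ext fun _ => ⟨fun h => (h hx).symm, fun h _ => h.symm⟩

lemma wholeExtension_of_notMem (r : N → Y) {x : X} (hx : x ∉ N) : wholeExtension r x = univ :=
  eq_univ_of_forall fun _ h => absurd h hx

variable [TopologicalSpace X] [TopologicalSpace Y]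

lemma upperHemicontinuous_wholeExtension (hN : IsOpen N) {r : N → Y} (hr : Continuous r) :
    UpperHemicontinuous (wholeExtension r) := by
  refine upperHemicontinuous_iff_forall_isOpen.2 fun x u hu hxu => ?_
  by_cases hx : x ∈ N
  · have hopen : IsOpen (Subtype.val '' (r ⁻¹' u)) :=
      hN.isOpenMap_subtype_val _ (hu.preimage hr)
    rw [wholeExtension_of_mem r hx, singleton_subset_iff] at hxu
    filter_upwards [hopen.mem_nhds ⟨⟨x, hx⟩, hxu, rfl⟩]
    rintro _ ⟨⟨x', hx'⟩, hx'u, rfl⟩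
    rwa [wholeExtension_of_mem r hx', singleton_subset_iff]
  · rw [wholeExtension_of_notMem r hx] at hxu
    exact Filter.Eventually.of_forall fun x' => (subset_univ _).trans hxu

lemma uscSingletonOrWhole_wholeExtension_comp {T : Type v} [TopologicalSpace T] (hN : IsOpen N)
    {r : N → Y} (hr : Continuous r) {m : T → X} (hm : Continuous m) :
    uscSingletonOrWhole T Y fun t => wholeExtension r (m t) := by
  refine ⟨(upperHemicontinuous_wholeExtension hN hr).comp hm, fun t => ?_⟩
  by_cases ht : m t ∈ N
  · exact Or.inl ⟨_, wholeExtension_of_mem r ht⟩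
  · exact Or.inr (wholeExtension_of_notMem r ht)

end WholeExtension

lemma exists_entourage_subset_ball_of_upperHemicontinuous {X : Type w} {Y : Type u}
    [UniformSpace X] [UniformSpace Y] [CompactSpace Y] {F : X → Set Y}
    (hF : UpperHemicontinuous F) {e : Y → X} (he : Continuous e) (hFe : ∀ y, F (e y) = {y})
    {U : Set (Y × Y)} (hU : U ∈ 𝓤 Y) :
    ∃ V ∈ 𝓤 X, ∀ y, ∀ x ∈ UniformSpace.ball (e y) V, F x ⊆ UniformSpace.ball y U := by
  obtain ⟨U', hU', hU'U⟩ := comp_mem_uniformity_sets hU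
  have hgraph : {p : Y × X | F p.2 ⊆ UniformSpace.ball p.1 U} ∈ 𝓝ˢ (range fun y => (y, e y)) := by
    refine mem_nhdsSet_iff_forall.2 (forall_mem_range.2 fun y => ?_)
    have hy : UniformSpace.ball y U' ∈ 𝓝ˢ (F (e y)) := by
      rw [hFe, nhdsSet_singleton]
      exact UniformSpace.ball_mem_nhds y hU'
    rw [nhds_prod_eq]
    filter_upwards [Filter.prod_mem_prod (mem_nhds_right y hU') (hF (e y) _ hy)]
    rintro ⟨y', x⟩ ⟨hy', hx⟩ z hz
    exact hU'U ⟨y, hy', subset_of_mem_nhdsSet hx hz⟩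
  have hcompact : IsCompact (range fun y => (y, e y)) :=
    isCompact_range (continuous_id.prodMk he)
  obtain ⟨V, hV, hVsub⟩ :=
    (hcompact.nhdsSet_basis_uniformity (𝓤 (Y × X)).basis_sets).mem_iff.1 hgraph
  obtain ⟨V₁, hV₁, V₂, hV₂, hVV⟩ := entourageProd_subset hV
  refine ⟨V₂, hV₂, fun y x (hx : (e y, x) ∈ V₂) => ?_⟩
  have hyx : ((y, e y), (y, x)) ∈ V := hVV ⟨refl_mem_uniformity hV₁, hx⟩
  exact hVsub (mem_iUnion₂.2 ⟨_, mem_range_self y, hyx⟩)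

section CubeEval

variable (Y : Type u) [TopologicalSpace Y]

/-- The evaluation map of `Y` into the cube `[0,1]^{C(Y,[0,1])}`, the latter regarded as a compact
convex subset of a real vector space. -/
def cubeEval (y : Y) : Icc (0 : C(Y, unitInterval) → ℝ) 1 :=
  ⟨fun f => f y, fun f => (f y).2.1, fun f => (f y).2.2⟩

lemma isClosedEmbedding_cubeEval [CompactSpace Y] [T2Space Y] :
    IsClosedEmbedding (cubeEval Y) := by
  have hcont : Continuous (cubeEval Y) := by
    unfold cubeEval
    fun_prop
  refine hcont.isClosedEmbedding fun x y hxy => by_contra fun hne => ?_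
  obtain ⟨f, hf, hfxy⟩ := separatesPoints_continuous_of_t35Space_Icc hne
  exact hfxy (Subtype.ext (congrFun (congrArg Subtype.val hxy) ⟨f, hf⟩))

end CubeEval

theorem theorem5p2_general (I : Type v) {Y : Type u} [UniformSpace Y] [CompactSpace Y]
    {E : Type w} [AddCommGroup E] [Module ℝ E] [UniformSpace E] [IsUniformAddGroup E]
    [ContinuousSMul ℝ E] [LocallyConvexSpace ℝ E] {S : Set E} (hS : Convex ℝ S)
    {e : Y → S} (he : Continuous e) {N : Set S} (hN : IsOpen N) (heN : ∀ y, e y ∈ N)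
    {r : N → Y} (hr : Continuous r) (hre : ∀ y, r ⟨e y, heN y⟩ = y)
    {B : Set (Set (Y × Y))} (hB : IsMinimalOpenUniformBase B) :
    ∃ (Q' : Set (FormalComb I Y)) (C : Q' → Set Y), Q' = univ ∧
      IsConvexity I B (UniformSpace.toTopologicalSpace : TopologicalSpace Y) uscSingletonOrWhole
        (range fun y : Y => ({y} : Set Y)) (fun A => (A : Set Y)) Q' C := by
  have hne : ∀ A ∈ range fun y : Y => ({y} : Set Y), A.Nonempty :=
    forall_mem_range.2 singleton_nonempty
  refine ⟨univ, fun q => wholeExtension r (FormalComb.barycenter hS (q.1.1, e ∘ q.1.2)), rfl,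
    hB, hne, fun A => hne A A.2, fun _ _ _ _ => subset_univ _, fun a K _ _ => ?_, fun U hU => ?_⟩
  · exact uscSingletonOrWhole_wholeExtension_comp hN hr
      (continuous_barycenter_simplexFace hS (e ∘ a) K)
  · have hre' (y : Y) : wholeExtension r (e y) = {y} := by
      rw [wholeExtension_of_mem r (heN y), hre]
    obtain ⟨V, hV, hVU⟩ := exists_entourage_subset_ball_of_upperHemicontinuous
      (upperHemicontinuous_wholeExtension hN hr) he hre' (hB.1.1.mem_of_mem hU)
    obtain ⟨V', hV', hV'V⟩ := exists_entourage_barycenter_mem_ball I hS hV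
    obtain ⟨W, hW, hWV'⟩ := hB.1.1.mem_iff.1
      (CompactSpace.uniformContinuous_of_continuous he hV')
    refine ⟨W, hW, ?_⟩
    rintro ⟨_, y, rfl⟩ ⟨q, _⟩ hq
    simp only [uniformNhd, biUnion_singleton] at hq ⊢
    exact hVU y _ (hV'V (e y) (q.1, e ∘ q.2) fun i hi => hWV' (hq i hi))

theorem theorem5p2 (I : Type v) [Infinite I] (Y : Type u) [UniformSpace Y] [CompactSpace Y]
    [T2Space Y] (hY : IsCompactANR Y) (B : Set (Set (Y × Y))) (hB : IsMinimalOpenUniformBase B) :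
    ∃ (Q' : Set (FormalComb I Y)) (C : Q' → Set Y), Q' = univ ∧
      IsConvexity I B (UniformSpace.toTopologicalSpace : TopologicalSpace Y) uscSingletonOrWhole
        (range fun y : Y => ({y} : Set Y)) (fun A => (A : Set Y)) Q' C := by
  obtain ⟨N, hN, heN, r, hr, hre⟩ := hY _ (cubeEval Y) (isClosedEmbedding_cubeEval Y)
  exact theorem5p2_general I (convex_Icc 0 1) (isClosedEmbedding_cubeEval Y).continuous
    hN heN hr hre hB
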